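/- Let $n$ be a natural number, let $\Lambda < \mathrm{GL}(n,\mathbb{C})$ be a finitely generated group and let $\Gamma < \Lambda$ be a torsion free, virtually unipotent subgroup; that is, the only element of finite order in $\Gamma$ is the identity, and $\Gamma$ has a finite index subgroup that is conjugate in $\mathrm{GL}(n,\mathbb{C})$ into the group of upper triangular matrices with ones along the diagonal. Let $\eta \in \Lambda$ be an element of infinite order that is semisimple, i.e. its Jordan decomposition $\eta = \eta_s\eta_u$ (with $\eta_s$ diagonalizable, $\eta_u - I_n$ nilpotent and $\eta_s\eta_u = \eta_u\eta_s$) has $\eta_u = I_n$. Then there exists a finite index subgroup $\Lambda_0 < \Lambda$ such that $\Gamma < \Lambda_0$ and $[\eta]_\Lambda \cap \Lambda_0 = \emptyset$, where $[\eta]_\Lambda = \{\, g^{-1}\eta g : g \in \Lambda \,\}$ is the $\Lambda$-conjugacy class of $\eta$. -/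

import Mathlib

open scoped MatrixGroups

/-- A complex matrix in `GL(n, ℂ)` is diagonalizable if it is conjugate in `GL(n, ℂ)` to a
diagonal matrix. -/
def IsDiagonalizable {n : ℕ} (s : GL (Fin n) ℂ) : Prop :=
  ∃ g : GL (Fin n) ℂ, ((g * s * g⁻¹ : GL (Fin n) ℂ) : Matrix (Fin n) (Fin n) ℂ).IsDiag

/-- `γ = s * u` is the (multiplicative) Jordan decomposition of `γ`: `s` is diagonalizable,
`u - 1` is nilpotent, and `s`, `u` commute. -/
structure IsJordanDecomposition {n : ℕ} (γ s u : GL (Fin n) ℂ) : Prop where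
  eq_mul : γ = s * u
  diagonalizable : IsDiagonalizable s
  nilpotent : IsNilpotent ((u : Matrix (Fin n) (Fin n) ℂ) - 1)
  comm : Commute s u

/-- `γ` is semisimple if the unipotent factor in its Jordan decomposition is trivial. -/
def IsSemisimpleElement {n : ℕ} (γ : GL (Fin n) ℂ) : Prop :=
  ∃ s : GL (Fin n) ℂ, IsJordanDecomposition γ s 1

theorem isSemisimpleElement_iff_isDiagonalizable {n : ℕ} (γ : GL (Fin n) ℂ) :
    IsSemisimpleElement γ ↔ IsDiagonalizable γ := by
  constructor
  · rintro ⟨s, h⟩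
    have e : γ = s := by simpa using h.eq_mul
    exact e ▸ h.diagonalizable
  · intro h
    exact ⟨γ, ⟨by simp, h, by simp, Commute.one_right γ⟩⟩

/-- A subgroup of `GL(n, ℂ)` is unipotent if it is conjugate in `GL(n, ℂ)` into the group of
upper triangular matrices with ones along the diagonal. -/
def IsUnipotentSubgroup {n : ℕ} (U : Subgroup (GL (Fin n) ℂ)) : Prop :=
  ∃ g : GL (Fin n) ℂ, ∀ u ∈ U,
    (∀ i, ((g * u * g⁻¹ : GL (Fin n) ℂ) : Matrix (Fin n) (Fin n) ℂ) i i = 1) ∧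
    (∀ i j, j < i → ((g * u * g⁻¹ : GL (Fin n) ℂ) : Matrix (Fin n) (Fin n) ℂ) i j = 0)

/-- A subgroup of `GL(n, ℂ)` is virtually unipotent if it has a finite index subgroup that is
unipotent. -/
def IsVirtuallyUnipotent {n : ℕ} (Γ : Subgroup (GL (Fin n) ℂ)) : Prop :=
  ∃ U : Subgroup (GL (Fin n) ℂ), U ≤ Γ ∧ U.IsFiniteRelIndex Γ ∧ IsUnipotentSubgroup U

/-- A subgroup is torsion free if its only element of finite order is the identity. -/
def IsTorsionFreeSubgroup {G : Type*} [Group G] (Γ : Subgroup G) : Prop :=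
  ∀ γ ∈ Γ, IsOfFinOrder γ → γ = 1

/-- The `Λ`-conjugacy class of `η`. -/
def conjClass {G : Type*} [Group G] (Λ : Subgroup G) (η : G) : Set G :=
  {x | ∃ g ∈ Λ, x = g⁻¹ * η * g}

/-! The characteristic polynomial of an `m`-th power separates `η` from `Γ`, and does so modulo an
ideal. For suitable `m > 0` it is `(X - 1) ^ n` on all of `Γ`, but not at `η`: a diagonalizable `η ^
m` with only eigenvalue `1` would be trivial. `Λ` has entries in a finitely generated domain `A`,
where a nonzero coefficient of the difference survives in a finite quotient `A ⧸ I`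
(`exists_finite_quotient_notMem`). The preimage of `Γ` mod `I` then contains no conjugate of `η`. -/

instance Int.isJacobsonRing : IsJacobsonRing ℤ := by
  rw [isJacobsonRing_iff_prime_eq]
  intro P hP
  by_cases hbot : P = ⊥
  · subst hbot
    refine le_antisymm (fun x hx => ?_) Ideal.le_jacobson
    -- The unit `x * x + 1` is `1` or `-1`, which forces `x = 0`.
    have hu := Ideal.mem_jacobson_bot.mp hx x
    rw [Ideal.mem_bot]
    rcases Int.isUnit_iff.mp hu with h | h <;> nlinarith
  · have := hP.isMaximal hbot
    exact Ideal.jacobson_eq_self_of_isMaximal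

/-- A field which is finitely generated as a ring is finite. -/
theorem Field.finite_of_finiteType_int (k : Type*) [Field k] [alg : Algebra ℤ k]
    [Algebra.FiniteType ℤ k] : Finite k := by
  obtain rfl : alg = Ring.toIntAlgebra k := Subsingleton.elim _ _
  -- Zariski's lemma over a Jacobson base ring.
  have hfin : Module.Finite ℤ k := finite_of_finite_type_of_isJacobsonRing ℤ k
  obtain ⟨p, hp⟩ := CharP.exists k
  have hp0 : p ≠ 0 := by
    rintro rfl
    have : CharZero k := CharP.charP_to_charZero k
    have hf : IsField ℤ := isField_of_isIntegral_of_isField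
      (FaithfulSMul.algebraMap_injective ℤ k) (Field.toIsField k)
    exact Int.not_isField hf
  refine Module.finite_of_fg_torsion k fun x => ⟨⟨(p : ℤ), ?_⟩, ?_⟩
  · exact mem_nonZeroDivisors_of_ne_zero (by exact_mod_cast hp0)
  · change (p : ℤ) • x = 0
    rw [Algebra.smul_def, eq_intCast, Int.cast_natCast, CharP.cast_eq_zero, zero_mul]

/-- In a domain which is finitely generated as a ring, every nonzero element survives in some
finite residue field. -/
theorem exists_finite_quotient_notMem {A : Type*} [CommRing A] [IsDomain A]
    [Algebra.FiniteType ℤ A] {c : A} (hc : c ≠ 0) :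
    ∃ I : Ideal A, Finite (A ⧸ I) ∧ c ∉ I := by
  have : IsJacobsonRing A := isJacobsonRing_of_finiteType (A := ℤ)
  -- The maximal ideals of a Jacobson domain intersect in zero, so one of them misses `c`.
  have hj : (⊥ : Ideal A).jacobson = ⊥ :=
    isJacobsonRing_iff_prime_eq.mp this ⊥ Ideal.isPrime_bot
  have hc' : c ∉ (⊥ : Ideal A).jacobson := by rwa [hj, Ideal.mem_bot]
  simp only [Ideal.jacobson, Submodule.mem_sInf, not_forall] at hc'
  obtain ⟨I, ⟨-, hI⟩, hcI⟩ := hc'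
  let := Ideal.Quotient.field I
  have : Algebra.FiniteType ℤ (A ⧸ I) :=
    Algebra.FiniteType.of_surjective (Ideal.Quotient.mkₐ ℤ I) Ideal.Quotient.mk_surjective
  exact ⟨I, Field.finite_of_finiteType_int (A ⧸ I), hcI⟩

theorem Matrix.GeneralLinearGroup.map_injective {n R S : Type*} [Fintype n] [DecidableEq n]
    [CommRing R] [CommRing S] {f : R →+* S} (hf : Function.Injective f) :
    Function.Injective (Matrix.GeneralLinearGroup.map (n := n) f) := by
  intro a b h
  ext i j
  apply hf
  rw [← Matrix.GeneralLinearGroup.map_apply, h, Matrix.GeneralLinearGroup.map_apply]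

theorem Matrix.GeneralLinearGroup.charpoly_map_pow {n R S : Type*} [Fintype n] [DecidableEq n]
    [CommRing R] [CommRing S] (f : R →+* S) (a : GL n R) (m : ℕ) :
    ((Matrix.GeneralLinearGroup.map f a ^ m : GL n S) : Matrix n n S).charpoly =
      ((a ^ m : GL n R) : Matrix n n R).charpoly.map f := by
  rw [← map_pow, ← Matrix.charpoly_map]
  rfl

theorem Matrix.GeneralLinearGroup.charpoly_conj {n R : Type*} [Fintype n] [DecidableEq n]
    [CommRing R] (g a : GL n R) :
    ((g * a * g⁻¹ : GL n R) : Matrix n n R).charpoly = (a : Matrix n n R).charpoly := by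
  rw [Units.val_mul, Units.val_mul, Matrix.coe_units_inv, Matrix.charpoly_units_conj]

/-- An invertible matrix lies in the image of `GL n A` for a subring `A` as soon as its entries
and those of its inverse lie in `A`. -/
theorem Matrix.GeneralLinearGroup.mem_range_map_val {n R K : Type*} [Fintype n] [DecidableEq n]
    [CommRing R] [CommRing K] [Algebra R K] (A : Subalgebra R K) (t : GL n K)
    (h : ∀ i j, t i j ∈ A) (h' : ∀ i j, t⁻¹ i j ∈ A) :
    t ∈ (Matrix.GeneralLinearGroup.map (n := n) A.val.toRingHom).range := by
  have hinj : Function.Injective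
      (fun M : Matrix n n A => M.map A.val.toRingHom) := Matrix.map_injective Subtype.val_injective
  let a : Matrix n n A := fun i j => ⟨t i j, h i j⟩
  let b : Matrix n n A := fun i j => ⟨t⁻¹ i j, h' i j⟩
  have ha : a.map A.val.toRingHom = t.val := by ext i j; rfl
  have hb : b.map A.val.toRingHom = (t⁻¹).val := by ext i j; rfl
  refine ⟨⟨a, b, hinj ?_, hinj ?_⟩, ?_⟩
  · simp only [Matrix.map_mul, ha, hb, Units.mul_inv]
    exact (Matrix.map_one _ (map_zero _) (map_one _)).symm
  · simp only [Matrix.map_mul, ha, hb, Units.inv_mul]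
    exact (Matrix.map_one _ (map_zero _) (map_one _)).symm
  · ext i j; rfl

/-- A finitely generated linear group has its entries in a finitely generated ring. -/
theorem exists_fg_subalgebra_le_range_map {n K : Type*} [Fintype n] [DecidableEq n]
    [CommRing K] {Λ : Subgroup (GL n K)} (hΛ : Λ.FG) :
    ∃ A : Subalgebra ℤ K, A.FG ∧
      Λ ≤ (Matrix.GeneralLinearGroup.map (n := n) A.val.toRingHom).range := by
  classical
  obtain ⟨T, rfl⟩ := hΛ
  let S : Set K := ⋃ t ∈ (T : Set (GL n K)), ⋃ i, ⋃ j, {t i j, t⁻¹ i j}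
  have hS : S.Finite := T.finite_toSet.biUnion fun t _ =>
    Set.finite_iUnion fun i => Set.finite_iUnion fun j => Set.toFinite _
  have hmem : ∀ t ∈ T, ∀ i j, t i j ∈ S ∧ t⁻¹ i j ∈ S := fun t ht i j => by
    constructor <;>
    · simp only [S, Set.mem_iUnion]
      exact ⟨t, ht, i, j, by simp⟩
  refine ⟨Algebra.adjoin ℤ S, ⟨hS.toFinset, by simp⟩, ?_⟩
  rw [Subgroup.closure_le]
  intro t ht
  exact Matrix.GeneralLinearGroup.mem_range_map_val _ t
    (fun i j => Algebra.subset_adjoin (hmem t ht i j).1)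
    (fun i j => Algebra.subset_adjoin (hmem t ht i j).2)

/-- Elements of a unipotent subgroup have characteristic polynomial `(X - 1) ^ n`. -/
theorem IsUnipotentSubgroup.charpoly_eq {n : ℕ} {U : Subgroup (GL (Fin n) ℂ)}
    (hU : IsUnipotentSubgroup U) {u : GL (Fin n) ℂ} (hu : u ∈ U) :
    (u : Matrix (Fin n) (Fin n) ℂ).charpoly = (Polynomial.X - 1) ^ n := by
  obtain ⟨g, hg⟩ := hU
  obtain ⟨h1, h2⟩ := hg u hu
  rw [← Matrix.GeneralLinearGroup.charpoly_conj g u, Matrix.charpoly_of_isUpperTriangular _ (fun i j hij => h2 i j hij)]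
  simp [h1]

/-- A diagonalizable element all of whose eigenvalues are `1` is trivial. -/
theorem IsDiagonalizable.eq_one {n : ℕ} {s : GL (Fin n) ℂ} (hs : IsDiagonalizable s)
    (h : (s : Matrix (Fin n) (Fin n) ℂ).charpoly = (Polynomial.X - 1) ^ n) : s = 1 := by
  obtain ⟨g, hg⟩ := hs
  set D : Matrix (Fin n) (Fin n) ℂ := (g * s * g⁻¹ : GL (Fin n) ℂ).val
  have hD : D.charpoly = (Polynomial.X - 1) ^ n :=
    (Matrix.GeneralLinearGroup.charpoly_conj g s).trans h
  rw [← hg.diagonal_diag, Matrix.charpoly_diagonal] at hD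
  have hdiag : ∀ i, D.diag i = 1 := fun i => by
    have h0 := congrArg (Polynomial.eval (D.diag i)) hD
    rw [Polynomial.eval_prod, Finset.prod_eq_zero (Finset.mem_univ i) (by simp)] at h0
    simp only [Polynomial.eval_pow, Polynomial.eval_sub, Polynomial.eval_X,
      Polynomial.eval_one] at h0
    exact sub_eq_zero.mp (eq_zero_of_pow_eq_zero h0.symm)
  have hone : g * s * g⁻¹ = 1 := by
    refine Units.ext ?_
    change D = 1
    rw [← hg.diagonal_diag, funext hdiag]
    exact Matrix.diagonal_one
  exact conj_eq_one_iff.mp hone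

theorem IsDiagonalizable.pow {n : ℕ} {s : GL (Fin n) ℂ} (hs : IsDiagonalizable s) (m : ℕ) :
    IsDiagonalizable (s ^ m) := by
  obtain ⟨g, hg⟩ := hs
  refine ⟨g, ?_⟩
  rw [← conj_pow, Units.val_pow_eq_pow_val, ← hg.diagonal_diag, Matrix.diagonal_pow]
  exact Matrix.isDiag_diagonal _

/-- A virtually unipotent group has an exponent `m` such that all `m`-th powers of its elements
have characteristic polynomial `(X - 1) ^ n`. -/
theorem IsVirtuallyUnipotent.exists_charpoly_pow_eq {n : ℕ} {Γ : Subgroup (GL (Fin n) ℂ)}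
    (hΓ : IsVirtuallyUnipotent Γ) :
    ∃ m : ℕ, 0 < m ∧ ∀ γ ∈ Γ,
      ((γ ^ m : GL (Fin n) ℂ) : Matrix (Fin n) (Fin n) ℂ).charpoly = (Polynomial.X - 1) ^ n := by
  obtain ⟨U, -, hfin, hU⟩ := hΓ
  -- `U` need not be normal in `Γ`, so the index itself may fail as exponent; but some positive
  -- power of `γ` up to the index lies in `U`, and its exponent divides the factorial.
  refine ⟨(U.relIndex Γ).factorial, Nat.factorial_pos _, fun γ hγ => hU.charpoly_eq ?_⟩
  exact (Subgroup.pow_mem_of_relIndex_ne_zero_of_dvd hfin.relIndex_ne_zero hγ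
    fun m h0 hm => Nat.dvd_factorial h0 hm).1

/-- If `φ` is a homomorphism to a finite group and the range of `f` contains `Λ`, then the image
under `f` of a subgroup pulled back along `φ` meets `Λ` in a subgroup of finite index. -/
theorem Subgroup.isFiniteRelIndex_map_comap_inf {G H F : Type*} [Group G] [Group H] [Group F]
    [Finite F] (f : G →* H) (φ : G →* F) (Q : Subgroup F) {Λ : Subgroup H} (hΛ : Λ ≤ f.range) :
    ((Q.comap φ).map f ⊓ Λ).IsFiniteRelIndex Λ := by
  rw [Subgroup.isFiniteRelIndex_iff_relIndex_ne_zero, Subgroup.inf_relIndex_right]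
  refine mt (fun h => Subgroup.relIndex_eq_zero_of_le_right hΛ h) ?_
  rw [MonoidHom.range_eq_map, Subgroup.relIndex_map_map]
  have : (Q.comap φ).FiniteIndex := ⟨by
    rw [Subgroup.index_comap]
    exact (inferInstance : (Q.subgroupOf φ.range).FiniteIndex).index_ne_zero⟩
  rw [top_sup_eq, Subgroup.relIndex_top_right]
  exact (Subgroup.finiteIndex_of_le (le_sup_left : Q.comap φ ≤ _ ⊔ f.ker)).index_ne_zero

theorem mainTheorem11 (n : ℕ) (Λ Γ : Subgroup (GL (Fin n) ℂ)) (hΛ : Λ.FG) (hΓΛ : Γ ≤ Λ)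
    (hΓ_tf : IsTorsionFreeSubgroup Γ) (hΓ_vu : IsVirtuallyUnipotent Γ)
    (η : GL (Fin n) ℂ) (hηΛ : η ∈ Λ) (hη_ss : IsSemisimpleElement η)
    (hη_inf : ¬ IsOfFinOrder η) :
    ∃ Λ₀ : Subgroup (GL (Fin n) ℂ), Λ₀ ≤ Λ ∧ Λ₀.IsFiniteRelIndex Λ ∧ Γ ≤ Λ₀ ∧
      conjClass Λ η ∩ (Λ₀ : Set (GL (Fin n) ℂ)) = ∅ := by
  obtain ⟨m, hm, hΓm⟩ := hΓ_vu.exists_charpoly_pow_eq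
  have hη : ((η ^ m : GL (Fin n) ℂ) : Matrix (Fin n) (Fin n) ℂ).charpoly ≠
      (Polynomial.X - 1) ^ n := fun h => hη_inf <| isOfFinOrder_iff_pow_eq_one.mpr
    ⟨m, hm, (((isSemisimpleElement_iff_isDiagonalizable η).mp hη_ss).pow m).eq_one h⟩
  obtain ⟨A, hA, hΛA⟩ := exists_fg_subalgebra_le_range_map hΛ
  have hAft : Algebra.FiniteType ℤ A := A.fg_iff_finiteType.mp hA
  set ι : A →+* ℂ := A.val.toRingHom
  have hι : Function.Injective ι := Subtype.val_injective
  set f : GL (Fin n) A →* GL (Fin n) ℂ := Matrix.GeneralLinearGroup.map ι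
  have hf : Function.Injective f := Matrix.GeneralLinearGroup.map_injective hι
  obtain ⟨e, rfl⟩ := hΛA hηΛ
  have hcp : ∀ a : GL (Fin n) A,
      ((f a ^ m : GL (Fin n) ℂ) : Matrix (Fin n) (Fin n) ℂ).charpoly = (Polynomial.X - 1) ^ n ↔
      ((a ^ m : GL (Fin n) A) : Matrix (Fin n) (Fin n) A).charpoly = (Polynomial.X - 1) ^ n := by
    intro a
    rw [Matrix.GeneralLinearGroup.charpoly_map_pow, ← (Polynomial.map_injective ι hι).eq_iff]
    simp
  rw [Ne, hcp, ← sub_eq_zero, Polynomial.ext_iff, not_forall] at hη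
  obtain ⟨k, hk⟩ := hη
  obtain ⟨I, hI, hkI⟩ := exists_finite_quotient_notMem hk
  set φ : GL (Fin n) A →* GL (Fin n) (A ⧸ I) :=
    Matrix.GeneralLinearGroup.map (Ideal.Quotient.mk I)
  refine ⟨(((Γ.comap f).map φ).comap φ).map f ⊓ Λ, inf_le_right,
    Subgroup.isFiniteRelIndex_map_comap_inf f φ _ hΛA, le_inf (fun γ hγ => ?_) hΓΛ, ?_⟩
  · obtain ⟨c, rfl⟩ := hΛA (hΓΛ hγ)
    exact ⟨c, ⟨c, hγ, rfl⟩, rfl⟩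
  · rw [Set.eq_empty_iff_forall_notMem]
    rintro x ⟨⟨g, hg, rfl⟩, ⟨b, ⟨c, hc, hcb⟩, hb⟩, -⟩
    obtain ⟨h, rfl⟩ := hΛA hg
    rw [← map_inv, ← map_mul, ← map_mul] at hb
    obtain rfl := hf hb
    apply hkI
    -- `c` comes from `Γ` and agrees mod `I` with a conjugate of `e`, so the `k`-th coefficient of
    -- the difference for `e` would lie in `I`.
    have h1 := (hcp c).mp (hΓm _ hc)
    have h2 : ((φ c ^ m : GL (Fin n) (A ⧸ I)) : Matrix (Fin n) (Fin n) (A ⧸ I)).charpoly =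
        ((φ e ^ m : GL (Fin n) (A ⧸ I)) : Matrix (Fin n) (Fin n) (A ⧸ I)).charpoly := by
      have hconj : φ c = (φ h)⁻¹ * φ e * (φ h)⁻¹⁻¹ := by
        rw [hcb, map_mul, map_mul, map_inv, inv_inv]
      rw [hconj, conj_pow, Matrix.GeneralLinearGroup.charpoly_conj]
    rw [Matrix.GeneralLinearGroup.charpoly_map_pow, Matrix.GeneralLinearGroup.charpoly_map_pow,
      h1] at h2
    rw [← Ideal.Quotient.eq_zero_iff_mem, ← Polynomial.coeff_map, Polynomial.map_sub, ← h2,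
      sub_self, Polynomial.coeff_zero]
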